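/- Let $b \ge 2$ be an integer and let $\theta \in (0,1)$ be irrational, with continued fraction expansion $\theta = [0; a_1, a_2, \ldots]$. A Sturmian word of slope $\theta$ is an infinite word obtained, for some $\rho \in [0,1)$, from one of the words $s_1 s_2 s_3 \ldots$ and $s'_1 s'_2 s'_3 \ldots$ over $\{0,1\}$, where $$s_n = \lfloor n\theta + \rho \rfloor - \lfloor (n-1)\theta + \rho \rfloor, \qquad s'_n = \lceil n\theta + \rho \rceil - \lceil (n-1)\theta + \rho \rceil \qquad (n \ge 1),$$ by replacing the letters $0$ and $1$ by two distinct letters. Let $\xi$ be a $b$-Sturmian number of slope $\theta$, that is, a real number such that the sequence of the $b$-ary digits of its fractional part $\xi - \lfloor \xi \rfloor$ is a Sturmian word of slope $\theta$ over two distinct digits from $\{0, 1, \ldots, b-1\}$. Then $\xi$ is a Liouville number (that is, for every integer $n \ge 1$ there are integers $p, q$ with $q > 1$ and $0 < |\xi - p/q| < q^{-n}$) if and only if the sequence $(a_k)_{k \ge 1}$ of partial quotients of $\theta$ is unbounded. -/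

import Mathlib

namespace Sturm

/-- The lower mechanical word `s₁ s₂ s₃ …` of slope `θ` and intercept `ρ`, where
`sₙ = ⌊n θ + ρ⌋ - ⌊(n - 1) θ + ρ⌋` for `n ≥ 1`; the letter `sₙ` sits at position `n - 1`. -/
noncomputable def lowerWord (θ ρ : ℝ) (n : ℕ) : ℤ :=
  ⌊((n : ℝ) + 1) * θ + ρ⌋ - ⌊(n : ℝ) * θ + ρ⌋

/-- The upper mechanical word `s'₁ s'₂ s'₃ …` of slope `θ` and intercept `ρ`, where
`s'ₙ = ⌈n θ + ρ⌉ - ⌈(n - 1) θ + ρ⌉` for `n ≥ 1`; the letter `s'ₙ` sits at position `n - 1`. -/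
noncomputable def upperWord (θ ρ : ℝ) (n : ℕ) : ℤ :=
  ⌈((n : ℝ) + 1) * θ + ρ⌉ - ⌈(n : ℝ) * θ + ρ⌉

/-- `w` is a Sturmian word of slope `θ` over some two-letter alphabet `{a, c} ⊆ A`: `θ` is an
irrational number in `[0, 1)` and, for some intercept `ρ ∈ [0, 1)`, the word `w` is obtained from
the lower or from the upper mechanical word of slope `θ` and intercept `ρ` (both are words over
`{0, 1}`) by writing `a` for `0` and `c` for `1`, where `a` and `c` are distinct letters. -/
def IsSturmianWord {A : Type*} (θ : ℝ) (w : ℕ → A) : Prop :=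
  Irrational θ ∧ 0 ≤ θ ∧ θ < 1 ∧
    ∃ ρ : ℝ, 0 ≤ ρ ∧ ρ < 1 ∧ ∃ a c : A, a ≠ c ∧
      ((∀ n, w n = if lowerWord θ ρ n = 0 then a else c) ∨
        (∀ n, w n = if upperWord θ ρ n = 0 then a else c))

/-- `ξ` is a `b`-Sturmian number of slope `θ`: the sequence of the digits after the point in the
`b`-ary expansion of `ξ` (the digits of its fractional part) is a Sturmian word of slope `θ`. -/
def IsSturmianNumber (b : ℕ) [NeZero b] (θ ξ : ℝ) : Prop :=
  IsSturmianWord θ (Real.digits (Int.fract ξ) b)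

/-- The set of the partial quotients `a₁, a₂, …` in the continued fraction expansion
`[⌊θ⌋; a₁, a₂, …]` of `θ`. -/
def partialQuotients (θ : ℝ) : Set ℝ :=
  {x | ∃ k : ℕ, (GenContFract.of θ).partDens.get? k = some x}

end Sturm

/-!
The equivalence goes through a property of the slope: `θ` has bounded partial quotients if and only
if it is badly approximable, `|m θ - p| ≥ 1 / (C m)` for some `C` (`bddAbove_partialQuotients_iff`,
from the determinant formula and the growth of the convergents).

A Sturmian word records the increments of `F n = ⌊n α + ρ⌋` with `α = ± θ`. If `q α` is very close
to the integer `p`, then `F (n + q) = F n + p` except when `n α + ρ` lies, modulo `1`, in an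
interval of length `|q α - p|`. Two exceptions at distance `d` make `d α` closer to an integer than
`q α` is to `p`, so exceptions are far apart and the word has long stretches of period `q` close to
its beginning. If the digits of `ξ` at positions `i` and `i + r` agree for `L` letters, then `(b ^
(i + r) - b ^ i) ξ` is at distance less than `b ^ (-L)` from an integer.

* If `θ` is not badly approximable, `L / (i + r)` can be made arbitrarily large
  (`CodesRotation.exists_long_agreesFrom`). As a coding of an irrational rotation is not eventually
  periodic, these fractions differ from `ξ`, and `ξ` is a Liouville number.

* If `θ` is badly approximable, for each `L` there is such an approximation `P / Q` with `i + r =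
  O(L)` (`CodesRotation.exists_agreesFrom_of_badlyApproximable`). A fraction `p / q` different from
  the `P / Q` of the scale `b ^ L ≈ 2 q` is at distance at least a fixed power of `1 / q` from `ξ`,
  because `|P / Q - p / q| ≥ 1 / (q Q)`. If `p / q = P / Q`, a lower bound for `|ξ - P / Q|` itself
  is needed: the period `r` breaks within `O(r)` letters, since the first `N` points of the orbit
  of a badly approximable rotation are `O(1 / N)`-dense (`BadlyApproximable.exists_abs_sub_le`,
  `one_le_abs_fract_sub_fract_mul_pow`). Hence the irrationality exponent of `ξ` is finite
  (`not_liouville_of_forall_scale`).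
-/

namespace Sturm

/-! ### Bounded partial quotients and bad approximability -/

/-- `α` is badly approximable with constant `1 / C`: `|m α - p| ≥ 1 / (C m)` for all integers `p`
and all `m ≥ 1`. The inequality is kept free of divisions. -/
def BadlyApproximable (C : ℕ) (α : ℝ) : Prop :=
  ∀ (m : ℕ) (p : ℤ), 0 < m → 1 ≤ C * m * |m * α - p|

theorem not_terminatedAt_of_irrational {θ : ℝ} (hθ : Irrational θ) (n : ℕ) :
    ¬ (GenContFract.of θ).TerminatedAt n := fun h => by
  obtain ⟨r, hr⟩ := (GenContFract.terminates_iff_rat θ).1 ⟨n, h⟩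
  exact hθ ⟨r, hr.symm⟩

/-- Numerators and denominators of the convergents are integers (as continuants `contsAux`). -/
theorem exists_int_contsAux (θ : ℝ) (n : ℕ) :
    ∃ p q : ℤ, (GenContFract.of θ).contsAux n = ⟨p, q⟩ := by
  induction n using Nat.strong_induction_on with
  | _ n ih =>
    match n with
    | 0 => exact ⟨1, 0, by simp [GenContFract.contsAux]⟩
    | 1 => exact ⟨⌊θ⌋, 1, by simp [GenContFract.contsAux, GenContFract.of_h_eq_floor]⟩
    | n + 2 =>
      obtain ⟨p, q, h⟩ := ih n (by omega)
      obtain ⟨p', q', h'⟩ := ih (n + 1) (by omega)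
      by_cases ht : (GenContFract.of θ).TerminatedAt n
      · exact ⟨p', q', by
          rw [GenContFract.contsAux_stable_step_of_terminated ht, h']⟩
      · obtain ⟨gp, hgp⟩ := Option.ne_none_iff_exists'.1 ht
        obtain ⟨h1, z, hz⟩ := GenContFract.of_partNum_eq_one_and_exists_int_partDen_eq hgp
        refine ⟨z * p' + p, z * q' + q, ?_⟩
        rw [GenContFract.contsAux_recurrence hgp h h']
        simp [h1, hz]

/-- The facts about convergents `p n / q n` and partial quotients `a n` of an irrational number that
are used below. -/
theorem exists_convergents {θ : ℝ} (hθ : Irrational θ) :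
    ∃ (a : ℕ → ℝ) (q : ℕ → ℕ) (p : ℕ → ℤ), partialQuotients θ = Set.range a ∧
      q 0 = 1 ∧ (∀ n, 0 < q n) ∧ (∀ n, n ≤ q n) ∧ Monotone q ∧
      (∀ n, a n * q n ≤ q (n + 1)) ∧ (∀ n, (q (n + 1) : ℝ) ≤ (a n + 1) * q n) ∧
      (∀ n, |q n * θ - p n| * q (n + 1) ≤ 1) ∧
      (∀ n, p n * q (n + 1) - q n * p (n + 1) ≠ 0) := by
  have hT := not_terminatedAt_of_irrational hθ
  have hs : ∀ n, ∃ gp, (GenContFract.of θ).s.get? n = some gp := fun n =>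
    Option.ne_none_iff_exists'.1 (hT n)
  choose gp hgp using hs
  choose P Q hPQ using exists_int_contsAux θ
  have hnum : ∀ n, (GenContFract.of θ).nums n = P (n + 1) := fun n => by
    rw [GenContFract.num_eq_conts_a, GenContFract.nth_cont_eq_succ_nth_contAux, hPQ]
  have hden : ∀ n, (GenContFract.of θ).dens n = Q (n + 1) := fun n => by
    rw [GenContFract.den_eq_conts_b, GenContFract.nth_cont_eq_succ_nth_contAux, hPQ]
  have hfib : ∀ n, (Nat.fib (n + 1) : ℤ) ≤ Q (n + 1) := fun n => by
    have := GenContFract.succ_nth_fib_le_of_nth_den (v := θ) (n := n) (Or.inr (hT _))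
    rw [hden] at this
    exact_mod_cast this
  have hQpos : ∀ n, 0 < Q (n + 1) := fun n =>
    lt_of_lt_of_le (by exact_mod_cast Nat.fib_pos.2 n.succ_pos) (hfib n)
  have hQcast : ∀ n, ((Q (n + 1)).toNat : ℤ) = Q (n + 1) := fun n =>
    Int.toNat_of_nonneg (hQpos n).le
  have hQcast' : ∀ n, ((Q (n + 1)).toNat : ℝ) = Q (n + 1) := fun n => by
    exact_mod_cast congrArg (Int.cast : ℤ → ℝ) (hQcast n)
  have hmono : ∀ n, (Q (n + 1) : ℝ) ≤ Q (n + 1 + 1) := fun n => by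
    have := GenContFract.of_den_mono (v := θ) (n := n)
    rwa [hden, hden] at this
  have hpd : ∀ n, (GenContFract.of θ).partDens.get? n = some (gp n).b := fun n =>
    GenContFract.partDen_eq_s_b (hgp n)
  refine ⟨fun n => (gp n).b, fun n => (Q (n + 1)).toNat, fun n => P (n + 1), ?_, ?_, ?_, ?_, ?_,
    ?_, ?_, ?_, ?_⟩
  · ext x
    simp only [partialQuotients, Set.mem_ofPred_eq, Set.mem_range, hpd, Option.some.injEq]
  · have h := hden 0
    rw [GenContFract.zeroth_den_eq_one] at h
    have : Q 1 = 1 := by exact_mod_cast h.symm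
    simp [this]
  · intro n
    have := hQpos n
    change 0 < (Q (n + 1)).toNat
    omega
  · intro n
    have h1 := hfib n
    have h2 := Nat.le_fib_add_one (n + 1)
    change n ≤ (Q (n + 1)).toNat
    omega
  · refine monotone_nat_of_le_succ fun n => ?_
    have : Q (n + 1) ≤ Q (n + 1 + 1) := by exact_mod_cast hmono n
    omega
  · intro n
    have := GenContFract.le_of_succ_get?_den (hpd n)
    rw [hden, hden] at this
    simpa only [hQcast'] using this
  · intro n
    simp only [hQcast']
    have ha := (GenContFract.of_partNum_eq_one_and_exists_int_partDen_eq (hgp n)).1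
    have hrec := GenContFract.contsAux_recurrence (hgp n) (hPQ n) (hPQ (n + 1))
    rw [hPQ] at hrec
    have hb : (Q (n + 2) : ℝ) = (gp n).b * Q (n + 1) + Q n := by
      have := congrArg GenContFract.Pair.b hrec
      simpa [ha] using this
    have hn : (Q n : ℝ) ≤ Q (n + 1) := by
      cases n with
      | zero =>
        have h0 := hPQ 0
        have : (Q 0 : ℝ) = 0 := by
          have := congrArg GenContFract.Pair.b h0
          simpa [GenContFract.contsAux] using this.symm
        rw [this]
        exact_mod_cast (hQpos 0).le
      | succ n => exact hmono n
    rw [hb]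
    linarith
  · intro n
    simp only [hQcast']
    have h := GenContFract.abs_sub_convs_le (hT n)
    rw [GenContFract.conv_eq_num_div_den, hnum, hden, hden] at h
    have h1 : (0 : ℝ) < Q (n + 1) := by exact_mod_cast hQpos n
    have h2 : (0 : ℝ) < Q (n + 1 + 1) := by exact_mod_cast hQpos (n + 1)
    rw [le_div_iff₀ (by positivity)] at h
    have : (Q (n + 1) : ℝ) * θ - P (n + 1) = Q (n + 1) * (θ - P (n + 1) / Q (n + 1)) := by
      field_simp
    rw [this, abs_mul, abs_of_pos h1]
    linarith
  · intro n h
    have := SimpContFract.determinant (s := SimpContFract.of θ) (n := n) (hT n)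
    change (GenContFract.of θ).nums n * (GenContFract.of θ).dens (n + 1) -
      (GenContFract.of θ).dens n * (GenContFract.of θ).nums (n + 1) = _ at this
    rw [hnum, hden, hden, hnum] at this
    simp only [hQcast] at h
    have h' : (P (n + 1) : ℝ) * Q (n + 1 + 1) - Q (n + 1) * P (n + 1 + 1) = 0 := by
      exact_mod_cast h
    rw [h'] at this
    exact absurd this.symm (pow_ne_zero _ (by norm_num))

/-- Two distinct fractions `p / m` and `p' / m'` cannot both be too close to `θ`. -/
theorem one_le_of_det_ne_zero {θ : ℝ} {m m' : ℕ} {p p' : ℤ} (h : (m' : ℤ) * p - m * p' ≠ 0) :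
    1 ≤ m' * |m * θ - p| + m * |m' * θ - p'| := by
  have h1 : (1 : ℝ) ≤ |(((m' : ℤ) * p - m * p' : ℤ) : ℝ)| := by
    exact_mod_cast Int.one_le_abs h
  have h2 : (((m' : ℤ) * p - m * p' : ℤ) : ℝ) = -(m' * (m * θ - p)) + m * (m' * θ - p') := by
    push_cast; ring
  rw [h2] at h1
  calc (1 : ℝ) ≤ _ := h1
    _ ≤ |-((m' : ℝ) * (m * θ - p))| + |(m : ℝ) * (m' * θ - p')| := abs_add_le _ _
    _ = _ := by rw [abs_neg, abs_mul, abs_mul, Nat.abs_cast, Nat.abs_cast]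

/-- An irrational number has bounded partial quotients if and only if it is badly approximable. -/
theorem bddAbove_partialQuotients_iff {θ : ℝ} (hθ : Irrational θ) :
    BddAbove (partialQuotients θ) ↔ ∃ C, BadlyApproximable C θ := by
  obtain ⟨a, q, p, ha, hq0, hqpos, hqn, hmono, haq, hqa, happ, hdet⟩ := exists_convergents hθ
  rw [ha]
  constructor
  · rintro ⟨B, hB⟩
    obtain ⟨A, hA⟩ := exists_nat_ge B
    have haA : ∀ n, a n ≤ A := fun n => (hB ⟨n, rfl⟩).trans hA
    refine ⟨4 * (A + 1), fun m r hm => ?_⟩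
    have hmR : (0 : ℝ) < m := by exact_mod_cast hm
    -- If `2 m ≤ q (n + 1)` and `r / m` differs from the `n`-th convergent, then the convergent
    -- keeps `m θ - r` away from `0` at the scale `1 / q n`.
    have key : ∀ n, 2 * m ≤ q (n + 1) → (q n : ℤ) * r - m * p n ≠ 0 →
        1 ≤ 2 * q n * |m * θ - r| := by
      intro n hn hne
      have h1 := one_le_of_det_ne_zero (θ := θ) hne
      have h2 : (2 * m : ℝ) ≤ q (n + 1) := by exact_mod_cast hn
      have h3 := happ n
      have h4 : |q n * θ - p n| * (2 * m) ≤ 1 :=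
        (mul_le_mul_of_nonneg_left h2 (abs_nonneg _)).trans h3
      linarith
    have hex : ∃ n, 2 * m ≤ q n := ⟨2 * m, hqn _⟩
    obtain ⟨k, hk⟩ : ∃ k, Nat.find hex = k + 1 := by
      refine Nat.exists_eq_succ_of_ne_zero fun h0 => ?_
      have := Nat.find_spec hex
      rw [h0, hq0] at this
      omega
    have hk1 : 2 * m ≤ q (k + 1) := hk ▸ Nat.find_spec hex
    have hk0 : q k < 2 * m := not_le.1 (Nat.find_min hex (by omega))
    have hk0R : (q k : ℝ) ≤ 2 * m := by exact_mod_cast hk0.le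
    have habs := abs_nonneg (m * θ - r)
    push_cast
    by_cases hD : (q k : ℤ) * r - m * p k = 0
    · have hD' : (q (k + 1) : ℤ) * r - m * p (k + 1) ≠ 0 := by
        intro h
        have : (m : ℤ) * (p k * q (k + 1) - q k * p (k + 1)) = 0 := by
          linear_combination q k * h - q (k + 1) * hD
        rcases mul_eq_zero.1 this with h0 | h0
        · omega
        · exact hdet k h0
      have h1 := key (k + 1) (hk1.trans (hmono (Nat.le_succ _))) hD'
      have h2 : (q (k + 1) : ℝ) ≤ (A + 1) * (2 * m) :=
        (hqa k).trans (mul_le_mul (by linarith [haA k]) hk0R (by positivity) (by positivity))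
      have h3 := mul_le_mul_of_nonneg_right h2 habs
      linarith
    · have h1 := key k hk1 hD
      have h3 := mul_le_mul_of_nonneg_right hk0R habs
      have h4 : (0 : ℝ) ≤ A * m * |m * θ - r| := by positivity
      linarith
  · rintro ⟨C, hC⟩
    refine ⟨C, ?_⟩
    rintro _ ⟨n, rfl⟩
    have h0 : (0 : ℝ) < q n := by exact_mod_cast hqpos n
    have h1 := hC (q n) (p n) (hqpos n)
    have h2 := happ n
    have hC0 : (0 : ℝ) ≤ C * q n := by positivity
    have h3 : (q (n + 1) : ℝ) ≤ C * q n := by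
      calc (q (n + 1) : ℝ) = 1 * q (n + 1) := by ring
        _ ≤ C * q n * |q n * θ - p n| * q (n + 1) := by gcongr
        _ = C * q n * (|q n * θ - p n| * q (n + 1)) := by ring
        _ ≤ C * q n * 1 := by gcongr
        _ = C * q n := by ring
    exact le_of_mul_le_mul_right ((haq n).trans h3) h0

theorem BadlyApproximable.neg {C : ℕ} {α : ℝ} (h : BadlyApproximable C α) :
    BadlyApproximable C (-α) := fun m p hm => by
  have := h m (-p) hm
  push_cast at this
  rwa [show (m : ℝ) * -α - p = -(m * α - -p) by ring, abs_neg]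

theorem BadlyApproximable.pos {C : ℕ} {α : ℝ} (h : BadlyApproximable C α) : 0 < C := by
  rcases Nat.eq_zero_or_pos C with rfl | h0
  · have := h 1 0 one_pos
    norm_num at this
  · exact h0

/-! ### Words coding a rotation -/

/-- The rotation orbit `n ↦ n α + ρ`, rounded down to integers. -/
noncomputable def orbitFloor (α ρ : ℝ) (n : ℕ) : ℤ := ⌊(n : ℝ) * α + ρ⌋

/-- The letters of `w` record the increments of `orbitFloor α ρ`: two letters are equal exactly when
the increments at their positions are. Lower mechanical words of slope `θ` are of this kind with
`α = θ`, upper ones with `α = -θ`. -/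
def CodesRotation {A : Type*} (α ρ : ℝ) (w : ℕ → A) : Prop :=
  ∀ m n, w m = w n ↔
    orbitFloor α ρ (m + 1) - orbitFloor α ρ m = orbitFloor α ρ (n + 1) - orbitFloor α ρ n

theorem orbitFloor_add (α ρ : ℝ) (q : ℕ) (p : ℤ) (n : ℕ) :
    orbitFloor α ρ (n + q) = ⌊(n : ℝ) * α + ρ + (q * α - p)⌋ + p := by
  rw [orbitFloor, ← Int.floor_add_intCast]
  congr 1
  push_cast
  ring

theorem abs_orbitFloor_sub_lt (α ρ : ℝ) (m n : ℕ) :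
    |((orbitFloor α ρ m - orbitFloor α ρ n : ℤ) : ℝ) - ((m : ℝ) - n) * α| < 1 := by
  have h1 := Int.floor_le ((m : ℝ) * α + ρ)
  have h2 := Int.lt_floor_add_one ((m : ℝ) * α + ρ)
  have h3 := Int.floor_le ((n : ℝ) * α + ρ)
  have h4 := Int.lt_floor_add_one ((n : ℝ) * α + ρ)
  rw [abs_lt]
  push_cast
  unfold orbitFloor
  constructor <;> linarith

/-- A Sturmian word codes the rotation by its slope or by the opposite of its slope. -/
theorem IsSturmianWord.exists_codesRotation {A : Type*} {θ : ℝ} {w : ℕ → A}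
    (hw : IsSturmianWord θ w) : ∃ α ρ, (α = θ ∨ α = -θ) ∧ CodesRotation α ρ w := by
  obtain ⟨-, h0, h1, ρ, -, -, a, c, hac, h | h⟩ := hw
  · refine ⟨θ, ρ, Or.inl rfl, fun m n => ?_⟩
    have key : ∀ n, lowerWord θ ρ n = orbitFloor θ ρ (n + 1) - orbitFloor θ ρ n := fun n => by
      simp [lowerWord, orbitFloor]
    have h01 : ∀ n, lowerWord θ ρ n = 0 ∨ lowerWord θ ρ n = 1 := fun n => by
      have := abs_lt.1 (abs_orbitFloor_sub_lt θ ρ (n + 1) n)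
      rw [← key] at this
      push_cast at this
      have h2 : (-1 : ℝ) < lowerWord θ ρ n := by linarith
      have h3 : (lowerWord θ ρ n : ℝ) < 2 := by linarith
      have h2' : -1 < lowerWord θ ρ n := by exact_mod_cast h2
      have h3' : lowerWord θ ρ n < 2 := by exact_mod_cast h3
      omega
    rw [← key, ← key, h, h]
    rcases h01 m with hm | hm <;> rcases h01 n with hn | hn <;> simp [hm, hn, hac, hac.symm]
  · refine ⟨-θ, -ρ, Or.inr rfl, fun m n => ?_⟩
    have key : ∀ n, upperWord θ ρ n = -(orbitFloor (-θ) (-ρ) (n + 1) - orbitFloor (-θ) (-ρ) n) := by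
      intro n
      simp only [upperWord, orbitFloor]
      rw [show ((n + 1 : ℕ) : ℝ) * -θ + -ρ = -(((n : ℝ) + 1) * θ + ρ) by push_cast; ring,
        show (n : ℝ) * -θ + -ρ = -((n : ℝ) * θ + ρ) by ring, Int.floor_neg, Int.floor_neg]
      ring
    have h01 : ∀ n, upperWord θ ρ n = 0 ∨ upperWord θ ρ n = 1 := fun n => by
      have := abs_lt.1 (abs_orbitFloor_sub_lt (-θ) (-ρ) (n + 1) n)
      rw [← neg_neg (orbitFloor (-θ) (-ρ) (n + 1) - _), ← key] at this
      push_cast at this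
      have h2 : (-1 : ℝ) < upperWord θ ρ n := by linarith
      have h3 : (upperWord θ ρ n : ℝ) < 2 := by linarith
      have h2' : -1 < upperWord θ ρ n := by exact_mod_cast h2
      have h3' : upperWord θ ρ n < 2 := by exact_mod_cast h3
      omega
    rw [← neg_inj (a := _ - _), ← key, ← key, h, h]
    rcases h01 m with hm | hm <;> rcases h01 n with hn | hn <;> simp [hm, hn, hac, hac.symm]

/-- The points `x` whose translate by `e` crosses an integer form an interval modulo `1`, of length
`|e|`; so two of them differ by less than `|e|` modulo `1`. -/
theorem exists_abs_sub_lt_of_floor_ne {x y e : ℝ} (hx : ⌊x + e⌋ ≠ ⌊x⌋) (hy : ⌊y + e⌋ ≠ ⌊y⌋) :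
    ∃ k : ℤ, |x - y - k| < |e| := by
  refine ⟨⌊x⌋ - ⌊y⌋, ?_⟩
  rw [Ne, Int.floor_eq_iff, not_and_or, not_le, not_lt] at hx hy
  have h1 := Int.floor_le x
  have h2 := Int.lt_floor_add_one x
  have h3 := Int.floor_le y
  have h4 := Int.lt_floor_add_one y
  push_cast
  rcases le_or_gt 0 e with he | he
  · rw [abs_of_nonneg he, abs_lt]
    constructor <;> rcases hx with hx | hx <;> rcases hy with hy | hy <;> linarith
  · rw [abs_of_neg he, abs_lt]
    constructor <;> rcases hx with hx | hx <;> rcases hy with hy | hy <;> linarith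

/-- Two positions at distance `d` where `q` fails to be a period (with increment `p`) force
`d α` to be closer to an integer than `q α` is to `p`. -/
theorem exists_abs_sub_lt_of_orbitFloor_ne {α ρ : ℝ} {q : ℕ} {p : ℤ} {n d : ℕ}
    (h : orbitFloor α ρ (n + q) ≠ orbitFloor α ρ n + p)
    (h' : orbitFloor α ρ (n + d + q) ≠ orbitFloor α ρ (n + d) + p) :
    ∃ k : ℤ, |d * α - k| < |q * α - p| := by
  rw [orbitFloor_add, Ne, add_left_inj] at h h'
  obtain ⟨k, hk⟩ := exists_abs_sub_lt_of_floor_ne h' h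
  refine ⟨k, ?_⟩
  rwa [show ((n + d : ℕ) : ℝ) * α + ρ - (n * α + ρ) - k = d * α - k by push_cast; ring] at hk

/-! ### Periodic stretches -/

/-- `w` has period `r` on the `L + r` letters from position `i` on. -/
def AgreesFrom {A : Type*} (w : ℕ → A) (i r L : ℕ) : Prop :=
  ∀ t < L, w (i + t) = w (i + r + t)

theorem CodesRotation.agreesFrom {A : Type*} {α ρ : ℝ} {w : ℕ → A} (hw : CodesRotation α ρ w)
    {i q L : ℕ} {p : ℤ}
    (h : ∀ n, i ≤ n → n ≤ i + L → orbitFloor α ρ (n + q) = orbitFloor α ρ n + p) :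
    AgreesFrom w i q L := fun t ht => by
  have h1 := h (i + t) (by omega) (by omega)
  have h2 := h (i + t + 1) (by omega) (by omega)
  rw [hw, show i + q + t + 1 = i + t + 1 + q by ring, show i + q + t = i + t + q by ring, h1, h2]
  ring

theorem CodesRotation.orbitFloor_add_eq {A : Type*} {α ρ : ℝ} {w : ℕ → A}
    (hw : CodesRotation α ρ w) {i r L : ℕ} (h : AgreesFrom w i r L) :
    ∀ t ≤ L, orbitFloor α ρ (i + t + r) =
      orbitFloor α ρ (i + t) + (orbitFloor α ρ (i + r) - orbitFloor α ρ i) := by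
  intro t
  induction t with
  | zero => simp
  | succ t ih =>
    intro ht
    have h1 := ih (by omega)
    have h2 := (hw _ _).1 (h t (by omega))
    rw [show i + r + t + 1 = i + (t + 1) + r by ring, show i + r + t = i + t + r by ring] at h2
    rw [← add_assoc] at h2 ⊢
    linarith

/-- If `q α` is at least as close to `p` as `d α` is to any integer, for all `0 < d ≤ S + 1`, then
the exceptions to the period `q` are more than `S + 1` apart: the word has period `q` either for
long from `i₀` on, or for long just after the first exception. -/
theorem CodesRotation.exists_agreesFrom {A : Type*} {α ρ : ℝ} {w : ℕ → A}
    (hw : CodesRotation α ρ w) {q S : ℕ} {p : ℤ}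
    (hgap : ∀ (d : ℕ) (k : ℤ), 0 < d → d ≤ S + 1 → |q * α - p| ≤ |d * α - k|) (i₀ K : ℕ) :
    AgreesFrom w i₀ q K ∨ ∃ i, i₀ ≤ i ∧ i ≤ i₀ + K + 1 ∧ AgreesFrom w i q S := by
  by_cases h : ∀ n, i₀ ≤ n → n ≤ i₀ + K → orbitFloor α ρ (n + q) = orbitFloor α ρ n + p
  · exact Or.inl (hw.agreesFrom h)
  · push Not at h
    obtain ⟨n, hn1, hn2, hn⟩ := h
    refine Or.inr ⟨n + 1, by omega, by omega, hw.agreesFrom (p := p) fun m hm1 hm2 => ?_⟩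
    by_contra hm
    obtain ⟨d, rfl⟩ := Nat.exists_eq_add_of_le (show n ≤ m by omega)
    obtain ⟨k, hk⟩ := exists_abs_sub_lt_of_orbitFloor_ne hn hm
    exact absurd hk (not_lt.2 (hgap d k (by omega) (by omega)))

/-- An approximation `p / q` of quality `(M + 1) q |q α - p| < 1` can be taken in lowest terms, and
then `q α` is at least as close to `p` as `d α` is to any integer for `0 < d ≤ M q`. -/
theorem exists_gap_of_not_badlyApproximable {α : ℝ} {M : ℕ}
    (h : ¬ BadlyApproximable (M + 1) α) :
    ∃ (q : ℕ) (p : ℤ), 0 < q ∧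
      ∀ (d : ℕ) (k : ℤ), 0 < d → d ≤ M * q → |q * α - p| ≤ |d * α - k| := by
  unfold BadlyApproximable at h
  push Not at h
  obtain ⟨m, p, hm, hmp⟩ := h
  obtain ⟨g, q, p', hg, hcop, hq, hp⟩ : ∃ (g q : ℕ) (p' : ℤ), 0 < g ∧ IsCoprime (q : ℤ) p' ∧
      m = q * g ∧ p = p' * g := by
    have hpos : 0 < Int.gcd m p := Int.gcd_pos_of_ne_zero_left _ (by omega)
    obtain ⟨x, y, hxy, hx, hy⟩ := Int.exists_gcd_one hpos
    have hx0 : 0 ≤ x := by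
      by_contra hneg
      have : x * (Int.gcd m p : ℤ) < 0 := mul_neg_of_neg_of_pos (by omega) (by omega)
      omega
    lift x to ℕ using hx0
    exact ⟨_, x, y, hpos, Int.isCoprime_iff_gcd_eq_one.2 hxy, by exact_mod_cast hx, hy⟩
  have hq0 : 0 < q := Nat.pos_of_ne_zero (by rintro rfl; omega)
  have hgR : (1 : ℝ) ≤ g := by exact_mod_cast hg
  have hsmall : ((M : ℝ) + 1) * q * |q * α - p'| < 1 := by
    refine lt_of_le_of_lt ?_ hmp
    rw [hq, hp]
    push_cast
    rw [show (q : ℝ) * g * α - p' * g = g * (q * α - p') by ring, abs_mul, Nat.abs_cast]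
    have h1 : (1 : ℝ) ≤ g * g := one_le_mul_of_one_le_of_one_le hgR hgR
    have h2 : 0 ≤ ((M : ℝ) + 1) * q * |q * α - p'| := by positivity
    calc ((M : ℝ) + 1) * q * |q * α - p'| ≤ (g * g) * (((M : ℝ) + 1) * q * |q * α - p'|) :=
          le_mul_of_one_le_left h2 h1
      _ = _ := by ring
  refine ⟨q, p', hq0, fun d k hd hdM => ?_⟩
  by_cases hdet : (q : ℤ) * k - d * p' = 0
  · have hdvd : (q : ℤ) ∣ d := hcop.dvd_of_dvd_mul_right ⟨k, by linarith⟩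
    obtain ⟨t, rfl⟩ := Int.natCast_dvd_natCast.1 hdvd
    have hk : k = t * p' := by
      have : (q : ℤ) * (k - t * p') = 0 := by push_cast at hdet; linarith
      rcases mul_eq_zero.1 this with h0 | h0 <;> omega
    have ht : (1 : ℝ) ≤ t := by exact_mod_cast Nat.pos_of_mul_pos_left hd
    rw [hk]
    push_cast
    rw [show (q : ℝ) * t * α - t * p' = t * (q * α - p') by ring, abs_mul, Nat.abs_cast]
    exact le_mul_of_one_le_left (abs_nonneg _) ht
  · by_contra! hlt
    have h1 := one_le_of_det_ne_zero (θ := α) hdet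
    have h2 : (d : ℝ) ≤ M * q := by exact_mod_cast hdM
    have h3 : (q : ℝ) * |d * α - k| ≤ q * |q * α - p'| := by gcongr
    have h4 : (d : ℝ) * |q * α - p'| ≤ M * q * |q * α - p'| := by gcongr
    linarith

/-- If `α` is not badly approximable, then a coding of the rotation by `α` has, after a prefix of
length `i`, a periodic stretch that is as long as desired compared to the prefix and the period. -/
theorem CodesRotation.exists_long_agreesFrom {A : Type*} {α ρ : ℝ} {w : ℕ → A}
    (hw : CodesRotation α ρ w) (hα : ∀ C, ¬ BadlyApproximable C α) (N : ℕ) :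
    ∃ i r L, 0 < i ∧ 0 < r ∧ N * (i + r) ≤ L ∧ AgreesFrom w i r L := by
  obtain ⟨q, p, hq, hgap⟩ := exists_gap_of_not_badlyApproximable
    (hα (N * (2 * N + 3) + 1 + 1))
  have hgap' : ∀ (d : ℕ) (k : ℤ), 0 < d → d ≤ N * (2 * N + 3) * q + 1 →
      |q * α - p| ≤ |d * α - k| := fun d k hd hdS => hgap d k hd (hdS.trans (by nlinarith))
  rcases hw.exists_agreesFrom hgap' 1 (2 * N * q) with h | ⟨i, hi1, hi2, h⟩
  · exact ⟨1, q, _, one_pos, hq, by nlinarith, h⟩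
  · refine ⟨i, q, _, hi1, hq, ?_, h⟩
    rw [mul_assoc]
    exact Nat.mul_le_mul_left N (by nlinarith)

/-- If `α` is badly approximable, then periodic stretches of any length `L` start and repeat within
a prefix of length `O(L)`. -/
theorem CodesRotation.exists_agreesFrom_of_badlyApproximable {A : Type*} {α ρ : ℝ} {w : ℕ → A}
    (hw : CodesRotation α ρ w) {C : ℕ} (hα : BadlyApproximable C α) {L : ℕ} (hL : 0 < L) :
    ∃ i r, 0 < r ∧ i + r ≤ 2 * (C + 1) * L ∧ AgreesFrom w i r L := by
  have hC := hα.pos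
  obtain ⟨q, hq, hqN, happ⟩ := Real.exists_nat_abs_mul_sub_round_le α
    (n := C * (L + 1)) (by positivity)
  have hgap : ∀ (d : ℕ) (k : ℤ), 0 < d → d ≤ L + 1 →
      |q * α - round (q * α)| ≤ |d * α - k| := by
    intro d k hd hdL
    refine happ.trans ?_
    rw [div_le_iff₀ (by positivity)]
    have h1 := hα d k hd
    have h2 : (d : ℝ) ≤ L + 1 := by exact_mod_cast hdL
    have h3 : (C : ℝ) * d * |d * α - k| ≤ C * (L + 1) * |d * α - k| := by gcongr
    push_cast
    linarith [abs_nonneg (d * α - k)]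
  rcases hw.exists_agreesFrom hgap 0 L with h | ⟨i, -, hi, h⟩
  · exact ⟨0, q, hq, by nlinarith, h⟩
  · exact ⟨i, q, hq, by nlinarith, h⟩

/-! ### Where a period breaks -/

/-- The first `N` points of the orbit of a badly approximable rotation are `2 C / N`-dense modulo
`1`: for a fraction `p / q` in lowest terms close to `α`, the points `n p / q` with `0 ≤ n < q` run
through all multiples of `1 / q` modulo `1`. -/
theorem BadlyApproximable.exists_abs_sub_le {C : ℕ} {α : ℝ} (hα : BadlyApproximable C α) {N : ℕ}
    (hN : 0 < N) (y : ℝ) : ∃ n < N, ∃ k : ℤ, |n * α - y - k| ≤ 2 * C / N := by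
  have hC : (1 : ℝ) ≤ C := by exact_mod_cast hα.pos
  have hNR : (0 : ℝ) < N := by exact_mod_cast hN
  obtain ⟨r, hr, hrN⟩ := Real.exists_rat_abs_sub_le_and_den_le α hN
  have hd : (0 : ℝ) < r.den := by exact_mod_cast r.den_pos
  have hr' : |α - r| * r.den ≤ 1 / N := by
    rw [le_div_iff₀ (by positivity)] at hr ⊢
    nlinarith [mul_nonneg (abs_nonneg (α - r)) hd.le]
  have hrd : |r.den * α - r.num| = |α - r| * r.den := by
    rw [← abs_of_pos hd, ← abs_mul, abs_of_pos hd]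
    congr 1
    have : (r : ℝ) * r.den = r.num := by exact_mod_cast Rat.mul_den_eq_num r
    linarith
  have hden : (1 : ℝ) / r.den ≤ C / N := by
    have h1 := hα r.den r.num r.den_pos
    rw [hrd] at h1
    rw [div_le_div_iff₀ hd hNR]
    have h2 : (C : ℝ) * r.den * (|α - r| * r.den) ≤ C * r.den * (1 / N) := by gcongr
    have h3 : 1 * (N : ℝ) ≤ C * r.den * (1 / N) * N := by gcongr; linarith
    rwa [mul_assoc _ (1 / (N : ℝ)), one_div_mul_cancel hNR.ne', mul_one] at h3
  obtain ⟨u, v, huv⟩ := Rat.isCoprime_num_den r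
  set m : ℤ := ⌊r.den * y⌋ with hm
  have hdZ : (0 : ℤ) < r.den := by exact_mod_cast r.den_pos
  -- `n` solves `n * r.num ≡ m` modulo `r.den`
  obtain ⟨n, hn⟩ : ∃ n : ℕ, (n : ℤ) = (u * m) % r.den :=
    ⟨((u * m) % r.den).toNat, Int.toNat_of_nonneg (Int.emod_nonneg _ hdZ.ne')⟩
  have hnlt : n < r.den := by
    have := Int.emod_lt_of_pos (u * m) hdZ
    omega
  obtain ⟨k, hk⟩ : ∃ k : ℤ, (n : ℤ) * r.num = m + k * r.den := by
    refine ⟨-(u * m / r.den) * r.num - v * m, ?_⟩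
    have := Int.emod_add_mul_ediv (u * m) r.den
    rw [← hn] at this
    linear_combination r.num * this + m * huv
  refine ⟨n, hnlt.trans_le hrN, k, ?_⟩
  have hkR : (n : ℝ) * r = m / r.den + k := by
    have h1 : (n : ℝ) * r.num = m + k * r.den := by exact_mod_cast hk
    have h2 : (r : ℝ) = r.num / r.den := by exact_mod_cast (Rat.num_div_den r).symm
    rw [h2]
    field_simp
    linarith
  have h1 : |(n : ℝ) * (α - r)| ≤ 1 / N := by
    rw [abs_mul, Nat.abs_cast]
    have : (n : ℝ) ≤ r.den := by exact_mod_cast hnlt.le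
    nlinarith [abs_nonneg (α - r)]
  have h2 : |(m : ℝ) / r.den - y| ≤ 1 / r.den := by
    have e : (m : ℝ) / r.den - y = (m - r.den * y) / r.den := by field_simp
    rw [e, abs_div, abs_of_pos hd]
    gcongr
    rw [abs_le]
    constructor <;> linarith [Int.floor_le (r.den * y), Int.lt_floor_add_one (r.den * y)]
  have h3 : (1 : ℝ) / N ≤ C / N := by gcongr
  calc |n * α - y - k| = |n * (α - r) + (m / r.den - y)| := by
        congr 1; linear_combination hkR
    _ ≤ |(n : ℝ) * (α - r)| + |(m : ℝ) / r.den - y| := abs_add_le _ _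
    _ ≤ 2 * C / N := by rw [mul_div_assoc]; linarith

/-- In a coding of a badly approximable rotation, a period `r` breaks within `O(r)` letters. -/
theorem CodesRotation.exists_ne_of_badlyApproximable {A : Type*} {α ρ : ℝ} {w : ℕ → A}
    (hw : CodesRotation α ρ w) {C : ℕ} (hα : BadlyApproximable C α) (i : ℕ) {r : ℕ} (hr : 0 < r) :
    ∃ t < 5 * C ^ 2 * r, w (i + t) ≠ w (i + r + t) := by
  by_contra! h
  set p := orbitFloor α ρ (i + r) - orbitFloor α ρ i
  set e := r * α - p with he
  have hC : (0 : ℝ) < C := by exact_mod_cast hα.pos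
  have hrR : (0 : ℝ) < r := by exact_mod_cast hr
  have hconst := hw.orbitFloor_add_eq h
  have hN : 0 < 5 * C ^ 2 * r := by have := hα.pos; positivity
  -- aim at the midpoint of the interval of exceptions to the period `r`
  obtain ⟨t, ht, k, hk⟩ := hα.exists_abs_sub_le hN (-e / 2 - (i * α + ρ))
  have he0 : 1 ≤ C * r * |e| := hα r p hr
  have hlt : 2 * (C : ℝ) / ((5 * C ^ 2 * r : ℕ) : ℝ) < |e| / 2 := by
    rw [div_lt_iff₀ (by exact_mod_cast hN)]
    push_cast
    nlinarith
  have hk' := abs_lt.1 (hk.trans_lt hlt)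
  have hc := hconst t ht.le
  rw [orbitFloor_add α ρ r p, add_left_inj, ← he, orbitFloor] at hc
  have h1 := Int.floor_le (((i + t : ℕ) : ℝ) * α + ρ)
  have h2 := Int.lt_floor_add_one (((i + t : ℕ) : ℝ) * α + ρ)
  have h3 := Int.floor_le (((i + t : ℕ) : ℝ) * α + ρ + e)
  have h4 := Int.lt_floor_add_one (((i + t : ℕ) : ℝ) * α + ρ + e)
  rw [hc] at h3 h4
  set f := ⌊((i + t : ℕ) : ℝ) * α + ρ⌋
  push_cast at h1 h2 h3 h4
  have hf : f < k ∧ k < f + 1 := by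
    have h5 : (f : ℝ) < k ∧ (k : ℝ) < f + 1 := by
      rcases le_or_gt 0 e with h0 | h0
      · rw [abs_of_nonneg h0] at hk'
        constructor <;> linarith
      · rw [abs_of_neg h0] at hk'
        constructor <;> linarith
    exact_mod_cast h5
  omega

/-- A coding of an irrational rotation is not eventually periodic. -/
theorem CodesRotation.exists_ne_of_irrational {A : Type*} {α ρ : ℝ} {w : ℕ → A}
    (hw : CodesRotation α ρ w) (hα : Irrational α) (i : ℕ) {r : ℕ} (hr : 0 < r) :
    ∃ t, w (i + t) ≠ w (i + r + t) := by
  by_contra! h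
  set p := orbitFloor α ρ (i + r) - orbitFloor α ρ i
  have hconst : ∀ t, orbitFloor α ρ (i + t + r) = orbitFloor α ρ (i + t) + p := fun t =>
    hw.orbitFloor_add_eq (fun s _ => h s) t le_rfl
  have hmul : ∀ s : ℕ, orbitFloor α ρ (i + s * r) = orbitFloor α ρ i + s * p := by
    intro s
    induction s with
    | zero => simp
    | succ s ih =>
      rw [show i + (s + 1) * r = i + s * r + r by ring, hconst, ih]
      push_cast; ring
  have hne : r * α - p ≠ 0 := fun h0 =>
    hα ⟨p / r, by
      have : (r : ℝ) ≠ 0 := by exact_mod_cast hr.ne'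
      push_cast
      rw [div_eq_iff this]; linarith⟩
  obtain ⟨s, hs⟩ := exists_nat_gt (1 / |r * α - p|)
  have h1 := abs_orbitFloor_sub_lt α ρ (i + s * r) i
  rw [hmul, abs_sub_comm] at h1
  push_cast at h1
  rw [show ((i : ℝ) + s * r - i) * α - (orbitFloor α ρ i + s * p - orbitFloor α ρ i) =
    s * (r * α - p) by ring, abs_mul, Nat.abs_cast] at h1
  rw [div_lt_iff₀ (abs_pos.2 hne)] at hs
  linarith

/-! ### Tails of the digit expansion -/

/-- Removing the first digit after the point of `b ^ n * ξ`. -/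
theorem fract_pow_succ_mul (b : ℕ) [NeZero b] (ξ : ℝ) (n : ℕ) :
    Int.fract ((b : ℝ) ^ (n + 1) * ξ) =
      b * Int.fract ((b : ℝ) ^ n * ξ) - (Real.digits (Int.fract ξ) b n : ℕ) := by
  have hb : b ≠ 0 := NeZero.ne b
  set x := Int.fract ξ with hx
  have hx0 : 0 ≤ x := Int.fract_nonneg ξ
  have hfr : ∀ m : ℕ, Int.fract ((b : ℝ) ^ m * ξ) = (b : ℝ) ^ m * x - ⌊(b : ℝ) ^ m * x⌋₊ := by
    intro m
    have h1 : (b : ℝ) ^ m * ξ = (b : ℝ) ^ m * x + ((b ^ m * ⌊ξ⌋ : ℤ) : ℝ) := by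
      rw [hx, ← Int.self_sub_floor]; push_cast; ring
    rw [h1, Int.fract_add_intCast, ← Int.self_sub_floor,
      natCast_floor_eq_intCast_floor (by positivity)]
  rw [hfr, hfr, Real.digits, Fin.val_ofNat]
  have h2 := Nat.cast_mul_floor_div_cancel (a := (b : ℝ) ^ n * x) hb
  have h3 := Nat.div_add_mod ⌊(b : ℝ) * ((b : ℝ) ^ n * x)⌋₊ b
  rw [h2] at h3
  rw [show x * (b : ℝ) ^ (n + 1) = b * ((b : ℝ) ^ n * x) by ring,
    show (b : ℝ) ^ (n + 1) * x = b * ((b : ℝ) ^ n * x) by ring]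
  have h4 : (b : ℝ) * ⌊(b : ℝ) ^ n * x⌋₊ + ((⌊(b : ℝ) * ((b : ℝ) ^ n * x)⌋₊ % b : ℕ) : ℝ) =
      ⌊(b : ℝ) * ((b : ℝ) ^ n * x)⌋₊ := by exact_mod_cast h3
  linarith

section Digits

variable {b : ℕ} [NeZero b] {ξ : ℝ}

/-- As long as the digits of two tails of the expansion of `ξ` agree, each further digit multiplies
the difference of the tails by `b`. -/
theorem fract_sub_fract_mul_pow {i r t : ℕ}
    (h : AgreesFrom (Real.digits (Int.fract ξ) b) i r t) :
    (Int.fract ((b : ℝ) ^ i * ξ) - Int.fract ((b : ℝ) ^ (i + r) * ξ)) * (b : ℝ) ^ t =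
      Int.fract ((b : ℝ) ^ (i + t) * ξ) - Int.fract ((b : ℝ) ^ (i + r + t) * ξ) := by
  induction t with
  | zero => simp
  | succ t ih =>
    have h1 := ih fun s hs => h s (by omega)
    rw [← add_assoc, ← add_assoc, fract_pow_succ_mul, fract_pow_succ_mul, h t (by omega), pow_succ]
    linear_combination (b : ℝ) * h1

theorem abs_fract_sub_fract_mul_pow_lt {i r L : ℕ}
    (h : AgreesFrom (Real.digits (Int.fract ξ) b) i r L) :
    |Int.fract ((b : ℝ) ^ i * ξ) - Int.fract ((b : ℝ) ^ (i + r) * ξ)| * (b : ℝ) ^ L < 1 := by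
  rw [← abs_of_nonneg (show (0 : ℝ) ≤ (b : ℝ) ^ L by positivity), ← abs_mul,
    fract_sub_fract_mul_pow h]
  rw [abs_lt]
  constructor <;> linarith [Int.fract_nonneg ((b : ℝ) ^ (i + L) * ξ),
    Int.fract_lt_one ((b : ℝ) ^ (i + L) * ξ), Int.fract_nonneg ((b : ℝ) ^ (i + r + L) * ξ),
    Int.fract_lt_one ((b : ℝ) ^ (i + r + L) * ξ)]

/-- A digit other than `b - 1` in position `s` of a tail keeps that tail away from `1`. -/
theorem one_le_one_sub_fract_mul_pow {n s : ℕ}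
    (h : (Real.digits (Int.fract ξ) b (n + s) : ℕ) ≠ b - 1) :
    1 ≤ (1 - Int.fract ((b : ℝ) ^ n * ξ)) * (b : ℝ) ^ (s + 1) := by
  have hb : 0 < b := NeZero.pos b
  induction s generalizing n with
  | zero =>
    have h1 := fract_pow_succ_mul b ξ n
    have h2 := Int.fract_nonneg ((b : ℝ) ^ (n + 1) * ξ)
    have h3 : (Real.digits (Int.fract ξ) b n : ℕ) + 2 ≤ b := by
      have := (Real.digits (Int.fract ξ) b n).isLt
      rw [add_zero] at h
      omega
    have h3' : ((Real.digits (Int.fract ξ) b n : ℕ) : ℝ) + 2 ≤ b := by exact_mod_cast h3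
    have h4 := Int.fract_lt_one ((b : ℝ) ^ (n + 1) * ξ)
    rw [zero_add, pow_one]
    linarith
  | succ s ih =>
    have h0 := ih (n := n + 1) (by rwa [show n + 1 + s = n + (s + 1) by ring])
    have h1 := fract_pow_succ_mul b ξ n
    have h3 : (Real.digits (Int.fract ξ) b n : ℕ) + 1 ≤ b := (Real.digits (Int.fract ξ) b n).isLt
    have h3' : ((Real.digits (Int.fract ξ) b n : ℕ) : ℝ) + 1 ≤ b := by exact_mod_cast h3
    refine h0.trans ?_
    rw [pow_succ _ (s + 1), mul_comm _ (b : ℝ), ← mul_assoc]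
    gcongr
    linarith

/-- If the digits of `ξ` code a badly approximable rotation, then the tails of its expansion at two
positions `r` apart differ by at least `b ^ (-O(r))`. Tails with different first digits might still
be close to each other, as `0.0999…` and `0.1000…` are; this is excluded since the digit `b - 1`
cannot be repeated too often. -/
theorem one_le_abs_fract_sub_fract_mul_pow {α ρ : ℝ} {C : ℕ} (hα : BadlyApproximable C α)
    (hw : CodesRotation α ρ (Real.digits (Int.fract ξ) b)) (i : ℕ) {r : ℕ} (hr : 0 < r) :
    1 ≤ |Int.fract ((b : ℝ) ^ i * ξ) - Int.fract ((b : ℝ) ^ (i + r) * ξ)| *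
      (b : ℝ) ^ (5 * C ^ 2 * r + 5 * C ^ 2 + 1) := by
  have hb : (1 : ℝ) ≤ b := by exact_mod_cast NeZero.pos b
  have hrun : ∀ n, 1 ≤ (1 - Int.fract ((b : ℝ) ^ n * ξ)) * (b : ℝ) ^ (5 * C ^ 2 + 1) := by
    intro n
    obtain ⟨t, ht, hne⟩ := hw.exists_ne_of_badlyApproximable hα n one_pos
    obtain ⟨s, hs, hd⟩ : ∃ s ≤ 5 * C ^ 2, (Real.digits (Int.fract ξ) b (n + s) : ℕ) ≠ b - 1 := by
      by_contra! hall
      refine hne (Fin.ext ?_)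
      rw [hall t (by omega), add_assoc, hall (1 + t) (by omega)]
    refine (one_le_one_sub_fract_mul_pow hd).trans ?_
    have := Int.fract_lt_one ((b : ℝ) ^ n * ξ)
    gcongr
  classical
  -- `t` is the first position where the two tails have different digits
  have hex := hw.exists_ne_of_badlyApproximable hα i hr
  have hspec := Nat.find_spec hex
  have hmin : AgreesFrom (Real.digits (Int.fract ξ) b) i r (Nat.find hex) := fun s hs => by
    by_contra hne
    exact Nat.find_min hex hs ⟨hs.trans hspec.1, hne⟩
  generalize Nat.find hex = t at hspec hmin
  obtain ⟨ht, hne⟩ := hspec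
  have hstep := fract_sub_fract_mul_pow hmin
  have h1 := fract_pow_succ_mul b ξ (i + t)
  have h2 := fract_pow_succ_mul b ξ (i + r + t)
  have h3 := hrun (i + t + 1)
  have h4 := hrun (i + r + t + 1)
  have h5 := Int.fract_nonneg ((b : ℝ) ^ (i + t + 1) * ξ)
  have h6 := Int.fract_nonneg ((b : ℝ) ^ (i + r + t + 1) * ξ)
  set B := (b : ℝ) ^ (5 * C ^ 2 + 1)
  have hB : 0 ≤ B := by positivity
  have hdig : (1 : ℝ) ≤ |((Real.digits (Int.fract ξ) b (i + t) : ℕ) : ℝ) -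
      (Real.digits (Int.fract ξ) b (i + r + t) : ℕ)| := by
    have : ((Real.digits (Int.fract ξ) b (i + t) : ℕ) : ℤ) -
      (Real.digits (Int.fract ξ) b (i + r + t) : ℕ) ≠ 0 := fun h0 => hne (Fin.ext (by omega))
    exact_mod_cast Int.one_le_abs this
  have hmain : 1 ≤ b * |Int.fract ((b : ℝ) ^ (i + t) * ξ) -
      Int.fract ((b : ℝ) ^ (i + r + t) * ξ)| * B := by
    rw [← abs_of_nonneg (show (0 : ℝ) ≤ b by positivity), ← abs_mul,
      abs_of_nonneg (show (0 : ℝ) ≤ b by positivity)]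
    rcases le_abs.1 hdig with h | h
    · refine h4.trans (mul_le_mul_of_nonneg_right (le_trans ?_ (le_abs_self _)) hB)
      linarith
    · refine h3.trans (mul_le_mul_of_nonneg_right (le_trans ?_ (neg_le_abs _)) hB)
      linarith
  rw [← hstep, abs_mul, abs_of_nonneg (show (0 : ℝ) ≤ (b : ℝ) ^ t by positivity)] at hmain
  set δ := |Int.fract ((b : ℝ) ^ i * ξ) - Int.fract ((b : ℝ) ^ (i + r) * ξ)|
  calc 1 ≤ b * (δ * (b : ℝ) ^ t) * B := hmain
    _ = δ * ((b : ℝ) ^ (t + 1) * B) := by ring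
    _ ≤ δ * ((b : ℝ) ^ (5 * C ^ 2 * r) * B) := by
        gcongr
        omega
    _ = _ := by rw [← pow_add, add_assoc]

/-- Subtracting two shifts of the expansion of `ξ` gives the rational approximations used on both
sides of the equivalence. -/
theorem pow_sub_pow_mul_sub_floor (b i r : ℕ) (ξ : ℝ) :
    (((b : ℤ) ^ (i + r) - (b : ℤ) ^ i : ℤ) : ℝ) * ξ -
        ((⌊(b : ℝ) ^ (i + r) * ξ⌋ - ⌊(b : ℝ) ^ i * ξ⌋ : ℤ) : ℝ) =
      Int.fract ((b : ℝ) ^ (i + r) * ξ) - Int.fract ((b : ℝ) ^ i * ξ) := by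
  rw [← Int.self_sub_floor, ← Int.self_sub_floor]
  push_cast
  ring

/-- If the tails of the expansion from two positions coincide, then the digits do. -/
theorem digits_eq_of_fract_eq {i r : ℕ}
    (h : Int.fract ((b : ℝ) ^ i * ξ) = Int.fract ((b : ℝ) ^ (i + r) * ξ)) (t : ℕ) :
    Real.digits (Int.fract ξ) b (i + t) = Real.digits (Int.fract ξ) b (i + r + t) := by
  have hz : ∀ t : ℕ, Int.fract ((b : ℝ) ^ (i + t) * ξ) = Int.fract ((b : ℝ) ^ (i + r + t) * ξ) := by
    intro t
    obtain ⟨z, hz⟩ := Int.fract_eq_fract.1 h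
    refine Int.fract_eq_fract.2 ⟨b ^ t * z, ?_⟩
    push_cast
    rw [← hz]
    ring
  have h1 := fract_pow_succ_mul b ξ (i + t)
  have h2 := fract_pow_succ_mul b ξ (i + r + t)
  have h3 := hz (t + 1)
  rw [← add_assoc, ← add_assoc, h1, h2, hz t] at h3
  refine Fin.ext ?_
  have : ((Real.digits (Int.fract ξ) b (i + t) : ℕ) : ℝ) =
    (Real.digits (Int.fract ξ) b (i + r + t) : ℕ) := by linarith
  exact_mod_cast this

/-- The approximations with denominators `b ^ (i + r) - b ^ i` coming from periodic stretches are of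
arbitrarily high order if `α` is not badly approximable. -/
theorem liouville_of_codesRotation (hb : 2 ≤ b) {α ρ : ℝ} (hirr : Irrational α)
    (hα : ∀ C, ¬ BadlyApproximable C α)
    (hw : CodesRotation α ρ (Real.digits (Int.fract ξ) b)) : Liouville ξ := by
  intro N
  obtain ⟨i, r, L, hi, hr, hL, hagree⟩ := hw.exists_long_agreesFrom hα N
  have hQP := pow_sub_pow_mul_sub_floor b i r ξ
  have hlt := abs_fract_sub_fract_mul_pow_lt hagree
  have hne : Int.fract ((b : ℝ) ^ i * ξ) ≠ Int.fract ((b : ℝ) ^ (i + r) * ξ) := fun h => by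
    obtain ⟨t, ht⟩ := hw.exists_ne_of_irrational hirr i hr
    exact ht (digits_eq_of_fract_eq h t)
  -- the condition `0 < i` is what makes the denominator greater than `1`
  have hQ1 : 1 < (b : ℤ) ^ (i + r) - (b : ℤ) ^ i := by
    have h1 : (2 : ℤ) ≤ (b : ℤ) ^ i := by
      exact_mod_cast hb.trans (Nat.le_self_pow hi.ne' b)
    have h2 : (2 : ℤ) ≤ (b : ℤ) ^ r := by
      exact_mod_cast hb.trans (Nat.le_self_pow hr.ne' b)
    rw [pow_add]
    nlinarith
  have hQle : (((b : ℤ) ^ (i + r) - (b : ℤ) ^ i : ℤ) : ℝ) ≤ (b : ℝ) ^ (i + r) := by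
    push_cast
    linarith [show (0 : ℝ) ≤ (b : ℝ) ^ i by positivity]
  generalize (b : ℤ) ^ (i + r) - (b : ℤ) ^ i = Q at hQP hQ1 hQle
  generalize ⌊(b : ℝ) ^ (i + r) * ξ⌋ - ⌊(b : ℝ) ^ i * ξ⌋ = P at hQP
  have hQ1R : (1 : ℝ) < Q := by exact_mod_cast hQ1
  have hQ0 : (0 : ℝ) < Q := by linarith
  have hsub : ξ - P / Q = (Q * ξ - P) / Q := by field_simp
  refine ⟨P, Q, hQ1, fun h => hne ?_, ?_⟩
  · rw [← sub_eq_zero, hsub, div_eq_zero_iff, or_iff_left hQ0.ne', hQP, sub_eq_zero] at h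
    exact h.symm
  · rw [abs_sub_comm, ← hQP] at hlt
    have hb1 : (1 : ℝ) ≤ b := by exact_mod_cast (by omega : 1 ≤ b)
    have hpow : (Q : ℝ) ^ N ≤ (b : ℝ) ^ L := by
      calc (Q : ℝ) ^ N ≤ ((b : ℝ) ^ (i + r)) ^ N := by gcongr
        _ = (b : ℝ) ^ (N * (i + r)) := by rw [← pow_mul, mul_comm]
        _ ≤ (b : ℝ) ^ L := pow_le_pow_right₀ hb1 hL
    rw [hsub, abs_div, abs_of_pos hQ0, lt_div_iff₀ (by positivity)]
    calc |Q * ξ - P| / Q * (Q : ℝ) ^ N ≤ |Q * ξ - P| * (b : ℝ) ^ L := by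
          gcongr
          exact div_le_self (abs_nonneg _) hQ1R.le
      _ < 1 := hlt

end Digits

/-! ### Finite irrationality exponent in the bounded case -/

/-- A criterion for a finite irrationality exponent: there are rational approximations `P / Q` at
every scale `b ^ L` whose denominators and errors `|Q ξ - P|` are controlled by fixed powers of the
scale. Any other fraction `p / q` is then kept away from `ξ` by comparison with the approximation
at the scale of `2 q`. -/
theorem not_liouville_of_forall_scale {b : ℕ} (hb : 2 ≤ b) {ξ : ℝ} {D : ℕ}
    (h : ∀ L : ℕ, 0 < L → ∃ P Q : ℤ, 0 < Q ∧ (Q : ℝ) ≤ (b : ℝ) ^ (D * L) ∧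
      |Q * ξ - P| * (b : ℝ) ^ L < 1 ∧ 1 ≤ |Q * ξ - P| * (b : ℝ) ^ (D * L)) :
    ¬ Liouville ξ := by
  intro hL
  obtain ⟨p, q, hq, -, hlt⟩ := hL ((b + 2) * (2 * D + 1))
  lift q to ℕ using by omega
  have hq2 : 2 ≤ q := by omega
  have hqR : (0 : ℝ) < q := by exact_mod_cast (by omega : 0 < q)
  have hb1 : (1 : ℝ) ≤ b := by exact_mod_cast (by omega : 1 ≤ b)
  simp only [Int.cast_natCast] at hlt
  -- the least scale with `2 q < b ^ L`
  set L := Nat.log b (2 * q) + 1 with hLdef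
  obtain ⟨P, Q, hQ, hQle, hup, hlow⟩ := h L (Nat.succ_pos _)
  have hQR : (0 : ℝ) < Q := by exact_mod_cast hQ
  have h2q : (2 * q : ℝ) ≤ (b : ℝ) ^ L := by
    exact_mod_cast (Nat.lt_pow_succ_log_self (by omega) (2 * q)).le
  have hbL : (b : ℝ) ^ L ≤ (q : ℝ) ^ (b + 2) := by
    have h1 : b ^ Nat.log b (2 * q) ≤ 2 * q := Nat.pow_log_le_self b (by omega)
    have h2 : b ≤ q ^ b := Nat.lt_two_pow_self.le.trans (Nat.pow_le_pow_left hq2 b)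
    have h3 : b ^ L ≤ q ^ (b + 2) := by
      calc b ^ L = b ^ Nat.log b (2 * q) * b := pow_succ _ _
        _ ≤ (q * q) * q ^ b := Nat.mul_le_mul (h1.trans (Nat.mul_le_mul_right q hq2)) h2
        _ = q ^ (b + 2) := by ring
    exact_mod_cast h3
  have hbD : ∀ k : ℕ, (1 : ℝ) ≤ (b : ℝ) ^ k := fun k => one_le_pow₀ hb1
  have hε : |q * ξ - p| = q * |ξ - p / q| := by
    rw [← abs_of_pos hqR, ← abs_mul, abs_of_pos hqR]
    congr 1
    field_simp
  have hfar : 1 ≤ |ξ - p / q| * (b : ℝ) ^ ((2 * D + 1) * L) := by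
    by_cases hdet : (q : ℤ) * P - Q * p = 0
    · have hPQ : |Q * ξ - P| = Q * |ξ - p / q| := by
        rw [← abs_of_pos hQR, ← abs_mul, abs_of_pos hQR]
        have : (q : ℝ) * P - Q * p = 0 := by exact_mod_cast hdet
        congr 1
        field_simp
        linarith
      rw [hPQ] at hlow
      calc 1 ≤ Q * |ξ - p / q| * (b : ℝ) ^ (D * L) := hlow
        _ ≤ (b : ℝ) ^ (D * L) * |ξ - p / q| * (b : ℝ) ^ (D * L) := by gcongr
        _ ≤ (b : ℝ) ^ (D * L) * |ξ - p / q| * (b : ℝ) ^ (D * L) * (b : ℝ) ^ L :=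
            le_mul_of_one_le_right (by positivity) (hbD L)
        _ = _ := by ring
    · lift Q to ℕ using hQ.le
      simp only [Int.cast_natCast] at hup hQle hQR
      have h1 := one_le_of_det_ne_zero (θ := ξ) hdet
      rw [hε] at h1
      have h2 : |Q * ξ - P| * (2 * q) ≤ |Q * ξ - P| * (b : ℝ) ^ L := by gcongr
      have h3 : 1 ≤ (2 * q : ℝ) * (Q * |ξ - p / q|) := by linarith
      calc 1 ≤ (2 * q : ℝ) * (Q * |ξ - p / q|) := h3
        _ ≤ (b : ℝ) ^ L * ((b : ℝ) ^ (D * L) * |ξ - p / q|) := by gcongr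
        _ ≤ (b : ℝ) ^ L * ((b : ℝ) ^ (D * L) * |ξ - p / q|) * (b : ℝ) ^ (D * L) :=
            le_mul_of_one_le_right (by positivity) (hbD _)
        _ = _ := by ring
  have hpow : (b : ℝ) ^ ((2 * D + 1) * L) ≤ (q : ℝ) ^ ((b + 2) * (2 * D + 1)) := by
    rw [mul_comm, pow_mul, pow_mul]
    gcongr
  rw [lt_div_iff₀ (by positivity)] at hlt
  exact absurd (hfar.trans (mul_le_mul_of_nonneg_left hpow (abs_nonneg _))) (not_le.2 hlt)

theorem not_liouville_of_codesRotation {b : ℕ} [NeZero b] {ξ : ℝ} (hb : 2 ≤ b) {α ρ : ℝ} {C : ℕ}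
    (hα : BadlyApproximable C α)
    (hw : CodesRotation α ρ (Real.digits (Int.fract ξ) b)) : ¬ Liouville ξ := by
  have hb1 : (1 : ℝ) ≤ b := by exact_mod_cast (by omega : 1 ≤ b)
  refine not_liouville_of_forall_scale hb
    (D := 2 * (C + 1) + (5 * C ^ 2 * (2 * (C + 1)) + 5 * C ^ 2 + 1)) fun L hL => ?_
  obtain ⟨i, r, hr, hir, hagree⟩ := hw.exists_agreesFrom_of_badlyApproximable hα hL
  refine ⟨⌊(b : ℝ) ^ (i + r) * ξ⌋ - ⌊(b : ℝ) ^ i * ξ⌋, (b : ℤ) ^ (i + r) - (b : ℤ) ^ i,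
    ?_, ?_, ?_, ?_⟩
  · have : (b : ℤ) ^ i < (b : ℤ) ^ (i + r) := pow_lt_pow_right₀ (by omega) (by omega)
    omega
  · have h1 : (b : ℝ) ^ (i + r) ≤ (b : ℝ) ^
        ((2 * (C + 1) + (5 * C ^ 2 * (2 * (C + 1)) + 5 * C ^ 2 + 1)) * L) :=
      pow_le_pow_right₀ hb1 (by nlinarith)
    push_cast
    linarith [show (0 : ℝ) ≤ (b : ℝ) ^ i by positivity]
  · rw [pow_sub_pow_mul_sub_floor, abs_sub_comm]
    exact abs_fract_sub_fract_mul_pow_lt hagree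
  · rw [pow_sub_pow_mul_sub_floor, abs_sub_comm]
    refine (one_le_abs_fract_sub_fract_mul_pow hα hw i hr).trans ?_
    gcongr
    have h1 : 5 * C ^ 2 * r ≤ 5 * C ^ 2 * (2 * (C + 1) * L) := Nat.mul_le_mul_left _ (by omega)
    have h2 : 5 * C ^ 2 + 1 ≤ (5 * C ^ 2 + 1) * L := Nat.le_mul_of_pos_right _ hL
    linarith [Nat.zero_le (2 * (C + 1) * L)]

end Sturm

theorem corollary2p5 (b : ℕ) [NeZero b] (hb : 2 ≤ b) (θ ξ : ℝ)
    (hξ : Sturm.IsSturmianNumber b θ ξ) :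
    Liouville ξ ↔ ¬ BddAbove (Sturm.partialQuotients θ) := by
  have hθ : Irrational θ := hξ.1
  obtain ⟨α, ρ, hα, hw⟩ := hξ.exists_codesRotation
  have hiff : ∀ C, Sturm.BadlyApproximable C α ↔ Sturm.BadlyApproximable C θ := fun C => by
    rcases hα with rfl | rfl
    · rfl
    · exact ⟨fun h => by simpa using h.neg, fun h => h.neg⟩
  have hirr : Irrational α := by
    rcases hα with rfl | rfl
    · exact hθ
    · exact hθ.neg
  rw [Sturm.bddAbove_partialQuotients_iff hθ]
  constructor
  · rintro hL ⟨C, hC⟩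
    exact Sturm.not_liouville_of_codesRotation hb ((hiff C).2 hC) hw hL
  · intro h
    exact Sturm.liouville_of_codesRotation hb hirr (fun C hC => h ⟨C, (hiff C).1 hC⟩) hw
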